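/- Let $m\ge 1$, and consider the linear equation with distributed delays $$\dot x(t)+a(t)x(t)+\sum_{k=1}^m b_k(t)\int_{h_k(t)}^t x(s)\,d_sR_k(t,s)=0,\qquad t\ge t_0\ge 0, \tag{E}$$ with initial condition $x(t)=\varphi(t)$ for $t\le t_0$, where $\varphi$ is continuous and bounded on $(-\infty,t_0]$. A solution is a function on $\mathbb R$ that is (locally) absolutely continuous on $[t_0,\infty)$, satisfies the equation for almost every $t\ge t_0$, and equals $\varphi$ on $(-\infty,t_0]$. Assume that - $a,b_1,\dots,b_m$ are Lebesgue measurable and essentially bounded on $[0,\infty)$, $a(t)\ge a_0>0$ and $b_k(t)\ge 0$ for $t\ge0$; - each $h_k$ is Lebesgue measurable, $h_k(t)\le t$ for $t\ge 0$, and $\lim_{t\to\infty}h_k(t)=\infty$; - for each $k$ and almost every $t\ge0$, $R_k(t,\cdot)$ is nondecreasing and $\int_{h_k(t)}^t d_sR_k(t,s)=1$ (these are Lebesgue–Stieltjes integrals over the closed interval $[h_k(t),t]$). Put $b(t)=\sum_{k=1}^m b_k(t)$, and suppose that $$h_0:=\limsup_{t\to\infty}\int_{\min_k h_k(t)}^t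 a(s)\,ds<\infty,\qquad \beta:=\limsup_{t\to\infty}\frac{b(t)}{a(t)}<\infty,$$ $$\frac1\beta e^{-h_0}>\ln\frac{\beta^2+\beta}{\beta^2+1},$$ where the last inequality is regarded as satisfied when $\beta=0$. Then (E) is exponentially stable: there are constants $M>0$ and $\alpha>0$ such that for every $t_0\ge0$ and every bounded continuous $\varphi$ on $(-\infty,t_0]$, each solution $x$ with initial function $\varphi$ satisfies $$|x(t)|\le M\,\|\varphi\|\,e^{-\alpha(t-t_0)},\qquad t\ge t_0,\qquad \|\varphi\|=\sup_{s\le t_0}|\varphi(s)|.$$ -/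

import Mathlib

open MeasureTheory Set Filter Topology
open scoped BoundedContinuousFunction

noncomputable section

open Classical in
/-- The Lebesgue-Stieltjes measure `dF` of a nondecreasing function `F` on the real line. It does
not depend on the values of `F` at its jumps, and `dF [u, v] = F (v+) - F (u-)`.
(It is set to `0` when `F` is not nondecreasing.) -/
def stieltjesMeasure (F : ℝ → ℝ) : Measure ℝ :=
  if hF : Monotone F then hF.stieltjesFunction.measure else 0

/-- `x` is a solution of
`x'(t) + a(t) x(t) + ∑ₖ bₖ(t) ∫_{[hₖ(t), t]} x(s) dₛRₖ(t, s) = 0` for `t ≥ t₀`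
with the initial condition `x(t) = φ(t)` for `t ≤ t₀`: it is (locally) absolutely continuous on
`[t₀, ∞)`, satisfies the equation for almost every `t ≥ t₀`, and agrees with `φ` on `(-∞, t₀]`. -/
structure IsSolution {m : ℕ} (a : ℝ → ℝ) (b h : Fin m → ℝ → ℝ) (R : Fin m → ℝ → ℝ → ℝ)
    (t₀ : ℝ) (φ : Iic t₀ →ᵇ ℝ) (x : ℝ → ℝ) : Prop where
  initial : ∀ s : Iic t₀, x s = φ s
  absolutelyContinuous : ∀ T, t₀ ≤ T → AbsolutelyContinuousOnInterval x t₀ T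
  equation : ∀ᵐ t ∂(volume.restrict (Ici t₀)), ∃ x' : ℝ, HasDerivAt x x' t ∧
    x' + a t * x t
      + ∑ k, b k t * ∫ s in Icc (h k t) t, x s ∂(stieltjesMeasure (R k t)) = 0

/-- Exponential stability: there are `M, α > 0` such that, for every initial point `t₀ ≥ 0` and
every bounded continuous initial function `φ` on `(-∞, t₀]`, each solution satisfies
`|x(t)| ≤ M ‖φ‖ exp (-α (t - t₀))` for `t ≥ t₀`, where `‖φ‖` is the sup-norm. -/
def ExponentiallyStable {m : ℕ} (a : ℝ → ℝ) (b h : Fin m → ℝ → ℝ)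
    (R : Fin m → ℝ → ℝ → ℝ) : Prop :=
  ∃ M > 0, ∃ α > 0, ∀ t₀ ≥ 0, ∀ (φ : Iic t₀ →ᵇ ℝ) (x : ℝ → ℝ),
    IsSolution a b h R t₀ φ x →
      ∀ t ≥ t₀, |x t| ≤ M * ‖φ‖ * Real.exp (-α * (t - t₀))

end

/-!
Run time at the rate `(1 - ε) a` and put `z t = exp (ε ∫₀ᵗ a) * x t`; exponential decay of `x`
follows from boundedness of `z`. For small `ε` and late times, `z` and `-z` satisfy a Yorke
condition: in the new time, `z' ≤ β' sup (-z)⁺ - z`, the supremum being over a window of length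
`h'`, where `β'` and `h'` are so slightly above `β` and `h₀` that the stability condition persists
(both are enlarged beforehand when they are small).

Suppose `|z| ≤ K` up to a time `T` at which `0 < z T`. If `z` has been positive for longer than a
window, the supremum vanishes and `z` decays, so `z T < K`. Otherwise let `v` be the last zero
before `T`. Going back from `v` with the Yorke condition gives `-β' K (exp (v - u) - 1) ≤ z u` for
`u ≤ v`, which for `u` close to `v` is better than `-K ≤ z u`. Inserting the better of the two
bounds into the Yorke condition after `v` and integrating, one finds `z T < K` once
`(β² + β) (1 + r) - (β + 1) exp (-h) < (β² + 1) exp r` for all `r`; minimising over `r` turns this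
into the stability condition. Hence `|z|` never exceeds a bound that it obeys on an initial interval
of two windows, and there it is controlled by the growth estimate `|x t| ≤ ‖φ‖ exp (∫ (a + ∑ bₖ))`.
-/

open scoped NNReal

theorem absolutelyContinuousOnInterval_comp_of_lipschitzOnWith {X Y : Type*}
    [PseudoMetricSpace X] [PseudoMetricSpace Y] {f : ℝ → X} {g : X → Y} {s t : ℝ} {K : ℝ≥0}
    (hg : LipschitzOnWith K g (f '' uIcc s t)) (hf : AbsolutelyContinuousOnInterval f s t) :
    AbsolutelyContinuousOnInterval (g ∘ f) s t := by
  have hK : Tendsto (fun E : ℕ × (ℕ → ℝ × ℝ) ↦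
      K * ∑ i ∈ Finset.range E.1, dist (f (E.2 i).1) (f (E.2 i).2))
      (AbsolutelyContinuousOnInterval.totalLengthFilter ⊓
        𝓟 (AbsolutelyContinuousOnInterval.disjWithin s t)) (𝓝 0) := by
    simpa using Tendsto.const_mul (K : ℝ) hf
  refine squeeze_zero' (.of_forall fun E ↦ Finset.sum_nonneg fun _ _ ↦ dist_nonneg) ?_ hK
  refine eventually_inf_principal.2 (.of_forall fun E hE ↦ ?_)
  rw [Finset.mul_sum]
  refine Finset.sum_le_sum fun i hi ↦ ?_
  have hmem := hE.1 i hi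
  exact hg.dist_le_mul _ (mem_image_of_mem f hmem.1) _ (mem_image_of_mem f hmem.2)

theorem absolutelyContinuousOnInterval_exp {f : ℝ → ℝ} {s t : ℝ}
    (hf : AbsolutelyContinuousOnInterval f s t) :
    AbsolutelyContinuousOnInterval (fun u ↦ Real.exp (f u)) s t := by
  obtain ⟨C, hC⟩ := hf.exists_bound
  have hsub : f '' uIcc s t ⊆ Icc (-C) C :=
    image_subset_iff.2 fun u hu ↦ abs_le.1 (hC u hu)
  obtain ⟨K, hK⟩ : ∃ K, LipschitzOnWith K Real.exp (Icc (-C) C) :=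
    (Real.contDiff_exp (n := 1)).contDiffOn.exists_lipschitzOnWith one_ne_zero (convex_Icc _ _)
      isCompact_Icc
  exact absolutelyContinuousOnInterval_comp_of_lipschitzOnWith (g := Real.exp) (hK.mono hsub) hf

theorem le_of_ae_deriv_nonpos {f : ℝ → ℝ} {s t : ℝ} (hst : s ≤ t)
    (hf : AbsolutelyContinuousOnInterval f s t)
    (hf' : ∀ᵐ u, u ∈ Ioo s t → ∃ f' : ℝ, HasDerivAt f f' u ∧ f' ≤ 0) : f t ≤ f s := by
  rw [← sub_nonpos, ← hf.integral_deriv_eq_sub, intervalIntegral.integral_of_le hst,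
    integral_Ioc_eq_integral_Ioo]
  refine integral_nonpos_of_ae ((ae_restrict_iff' measurableSet_Ioo).2 ?_)
  filter_upwards [hf'] with u hu hmem
  obtain ⟨f', hderiv, hle⟩ := hu hmem
  exact hderiv.deriv.trans_le hle

theorem abs_le_of_forall_abs_lt {z : ℝ → ℝ} {s t N : ℝ} (hst : s ≤ t)
    (hz : ContinuousOn z (Icc s t)) (hs : |z s| ≤ N)
    (hstep : ∀ K > N, ∀ T ∈ Ioc s t, (∀ u ∈ Icc s T, |z u| ≤ K) → |z T| < K) : |z t| ≤ N := by
  obtain ⟨T, hT, hmax⟩ := isCompact_Icc.exists_isMaxOn (nonempty_Icc.2 hst) hz.abs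
  refine (hmax (right_mem_Icc.2 hst)).trans (not_lt.1 fun hN ↦ ?_)
  have hsT : s < T := hT.1.lt_of_ne fun h ↦ (h ▸ hs).not_gt hN
  exact lt_irrefl _ (hstep _ hN T ⟨hsT, hT.2⟩ fun u hu ↦ hmax ⟨hu.1, hu.2.trans hT.2⟩)

theorem exists_last_zero_or_forall_pos {z : ℝ → ℝ} {s t : ℝ}
    (hz : ContinuousOn z (Icc s t)) (ht : 0 < z t) :
    (∃ v ∈ Ico s t, z v = 0 ∧ ∀ u ∈ Ioc v t, 0 < z u) ∨ ∀ u ∈ Icc s t, 0 < z u := by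
  refine or_iff_not_imp_right.2 fun hneg ↦ ?_
  push Not at hneg
  obtain ⟨u₀, hu₀, hzu₀⟩ := hneg
  have hcompact : IsCompact (Icc s t ∩ z ⁻¹' Iic 0) :=
    isCompact_Icc.of_isClosed_subset (hz.preimage_isClosed_of_isClosed isClosed_Icc isClosed_Iic)
      inter_subset_left
  obtain ⟨v, ⟨hv, hzv⟩, hmax⟩ := hcompact.exists_isGreatest ⟨u₀, hu₀, hzu₀⟩
  have hpos : ∀ u ∈ Ioc v t, 0 < z u := fun u hu ↦
    not_le.1 fun h ↦ hu.1.not_ge (hmax ⟨⟨hv.1.trans hu.1.le, hu.2⟩, h⟩)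
  have hvt : v < t := hv.2.lt_of_ne fun h ↦ (h ▸ ht).not_ge hzv
  obtain ⟨w, hw, hzw⟩ := intermediate_value_Icc hv.2 (hz.mono (Icc_subset_Icc_left hv.1))
    ⟨hzv, ht.le⟩
  obtain rfl : v = w := hw.1.eq_of_not_lt fun h ↦ (hpos w ⟨h, hw.2⟩).ne' hzw
  exact ⟨v, ⟨hv.1, hvt⟩, hzw, hpos⟩

/-- `P` is a primitive of the positive, locally integrable function `p`. It plays the role of a
new time variable, in which the equation `z' = p(t) (f - z)` has unit rate. -/
structure IsClock (P p : ℝ → ℝ) : Prop where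
  pos : ∀ t, 0 < p t
  locallyIntegrable : LocallyIntegrable p
  integral_eq_sub : ∀ s t, ∫ u in s..t, p u = P t - P s

theorem exists_isClock_eqOn {f : ℝ → ℝ} (hf : LocallyIntegrableOn f (Ici 0))
    (hpos : ∀ t, 0 ≤ t → 0 < f t) : ∃ P p, IsClock P p ∧ EqOn p f (Ici 0) := by
  classical
  set p := (Ici (0 : ℝ)).piecewise f 1
  have hp : LocallyIntegrable p := by
    refine locallyIntegrable_iff.2 fun k hk ↦
      Integrable.piecewise measurableSet_Ici ?_ (integrableOn_const hk.measure_ne_top).integrableOn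
    rw [IntegrableOn, Measure.restrict_restrict measurableSet_Ici]
    exact hf.integrableOn_compact_subset inter_subset_left (hk.inter_left isClosed_Ici)
  have hint : ∀ s t, IntervalIntegrable p volume s t := fun s t ↦
    (hp.integrableOn_isCompact isCompact_uIcc).intervalIntegrable
  refine ⟨fun t ↦ ∫ u in 0..t, p u, p, ⟨fun t ↦ ?_, hp, fun s t ↦ ?_⟩, piecewise_eqOn _ _ _⟩
  · by_cases ht : t ∈ Ici 0
    · simpa only [p, piecewise_eq_of_mem _ _ _ ht] using hpos t ht
    · simp only [p, piecewise_eq_of_notMem _ _ _ ht, Pi.one_apply, one_pos]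
  · exact (intervalIntegral.integral_interval_sub_left (hint _ _) (hint _ _)).symm

namespace IsClock

variable {P p Q q : ℝ → ℝ}

theorem intervalIntegrable (hP : IsClock P p) (s t : ℝ) : IntervalIntegrable p volume s t :=
  (hP.locallyIntegrable.integrableOn_isCompact isCompact_uIcc).intervalIntegrable

theorem eq_integral_add (hP : IsClock P p) (s : ℝ) : P = fun t ↦ (∫ u in s..t, p u) + P s :=
  funext fun t ↦ by rw [hP.integral_eq_sub, sub_add_cancel]

theorem strictMono (hP : IsClock P p) : StrictMono P := fun s t hst ↦ by
  rw [← sub_pos, ← hP.integral_eq_sub]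
  exact intervalIntegral.intervalIntegral_pos_of_pos (hP.intervalIntegrable s t) hP.pos hst

theorem absolutelyContinuous (hP : IsClock P p) (s t : ℝ) :
    AbsolutelyContinuousOnInterval P s t := by
  rw [hP.eq_integral_add s]
  exact ((hP.intervalIntegrable s t).absolutelyContinuousOnInterval_intervalIntegral
    left_mem_uIcc).add (contDiff_const.contDiffOn.absolutelyContinuousOnInterval)

theorem continuous (hP : IsClock P p) : Continuous P := by
  refine continuous_iff_continuousAt.2 fun t ↦ ?_
  have h := (hP.absolutelyContinuous (t - 1) (t + 1)).continuousOn
  rw [uIcc_of_le (by linarith)] at h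
  exact h.continuousAt (Icc_mem_nhds (by linarith) (by linarith))

theorem ae_hasDerivAt (hP : IsClock P p) : ∀ᵐ t, HasDerivAt P (p t) t := by
  filter_upwards [LocallyIntegrable.ae_hasDerivAt_integral hP.locallyIntegrable] with t ht
  rw [hP.eq_integral_add 0]
  exact (ht 0).add_const _

theorem const_mul (hP : IsClock P p) {c : ℝ} (hc : 0 < c) :
    IsClock (fun t ↦ c * P t) (fun t ↦ c * p t) where
  pos t := mul_pos hc (hP.pos t)
  locallyIntegrable := hP.locallyIntegrable.smul c
  integral_eq_sub s t := by
    rw [intervalIntegral.integral_const_mul, hP.integral_eq_sub, mul_sub]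

theorem sub_le_mul_sub (hP : IsClock P p) (hQ : IsClock Q q) {s t c : ℝ} (hst : s ≤ t)
    (hqp : ∀ u ∈ Icc s t, q u ≤ c * p u) : Q t - Q s ≤ c * (P t - P s) := by
  rw [← hP.integral_eq_sub, ← hQ.integral_eq_sub, ← intervalIntegral.integral_const_mul]
  exact intervalIntegral.integral_mono_on hst (hQ.intervalIntegrable s t)
    ((hP.intervalIntegrable s t).const_mul c) hqp

theorem mul_sub_le (hP : IsClock P p) {s t c : ℝ} (hst : s ≤ t)
    (hp : ∀ u ∈ Icc s t, c ≤ p u) : c * (t - s) ≤ P t - P s := by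
  rw [← hP.integral_eq_sub, mul_comm, ← smul_eq_mul, ← intervalIntegral.integral_const]
  exact intervalIntegral.integral_mono_on hst intervalIntegrable_const
    (hP.intervalIntegrable s t) hp

theorem exists_eq (hP : IsClock P p) {s t y : ℝ} (hst : s ≤ t) (hsy : P s ≤ y) (hyt : y ≤ P t) :
    ∃ v ∈ Icc s t, P v = y :=
  intermediate_value_Icc hst hP.continuous.continuousOn ⟨hsy, hyt⟩

theorem exists_eq_add (hP : IsClock P p) {s c ℓ : ℝ} (hc : 0 < c) (hp : ∀ u ≥ s, c ≤ p u)
    (hℓ : 0 ≤ ℓ) : ∃ t ≥ s, P t = P s + ℓ := by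
  have hs : s ≤ s + ℓ / c := le_add_of_nonneg_right (by positivity)
  have hle := hP.mul_sub_le hs fun u hu ↦ hp u hu.1
  rw [add_sub_cancel_left, mul_div_cancel₀ _ hc.ne'] at hle
  obtain ⟨t, ht, heq⟩ := hP.exists_eq (y := P s + ℓ) hs (by linarith) (by linarith)
  exact ⟨t, ht.1, heq⟩

theorem max_sub_le (hP : IsClock P p) {r s t : ℝ} (hrs : r ≤ s) (hrt : r ≤ t) :
    P (max s t) - P s ≤ P t - P r := by
  have hs := hP.strictMono.monotone hrs
  have ht := hP.strictMono.monotone hrt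
  rcases max_choice s t with h | h <;> rw [h] <;> linarith

/-- Variation of constants. -/
theorem exp_mul_le_add (hP : IsClock P p) {z : ℝ → ℝ} {s t c₀ c₁ : ℝ} (hst : s ≤ t)
    (hz : AbsolutelyContinuousOnInterval z s t)
    (hz' : ∀ᵐ u, u ∈ Ioo s t → ∃ z' : ℝ, HasDerivAt z z' u ∧
      z' ≤ p u * (c₀ + c₁ * Real.exp (P s - P u) - z u)) :
    Real.exp (P t - P s) * z t
      ≤ z s + c₀ * (Real.exp (P t - P s) - 1) + c₁ * (P t - P s) := by
  have hE : AbsolutelyContinuousOnInterval (fun u ↦ Real.exp (P u - P s)) s t :=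
    absolutelyContinuousOnInterval_exp ((hP.absolutelyContinuous s t).sub
      (contDiff_const.contDiffOn.absolutelyContinuousOnInterval))
  have hmono := le_of_ae_deriv_nonpos hst (((hE.mul hz).sub (hE.const_mul c₀)).sub
      ((hP.absolutelyContinuous s t).const_mul c₁)) (by
    filter_upwards [hz', hP.ae_hasDerivAt] with u hu hPu hmem
    obtain ⟨z', hderiv, hle⟩ := hu hmem
    have hexp := (hPu.sub_const (P s)).exp
    refine ⟨_, ((hexp.mul hderiv).sub (hexp.const_mul c₀)).sub (hPu.const_mul c₁), ?_⟩
    have hinv : Real.exp (P u - P s) * Real.exp (P s - P u) = 1 := by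
      rw [← Real.exp_add, sub_add_sub_cancel, sub_self, Real.exp_zero]
    linear_combination Real.exp (P u - P s) * hle + p u * c₁ * hinv)
  simp only [Pi.sub_apply, Pi.mul_apply, sub_self, Real.exp_zero] at hmono
  linarith

end IsClock

/-- The constants for which the Yorke condition below forces stability: the stability condition
together with a lower bound on `h`, which can always be achieved by increasing `h`. -/
structure IsAdmissible (β h : ℝ) : Prop where
  pos : 0 < β
  one_add_inv_le_exp : 1 + 1 / β ≤ Real.exp h
  log_lt : Real.log ((β ^ 2 + β) / (β ^ 2 + 1)) < 1 / β * Real.exp (-h)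

namespace IsAdmissible

variable {β h : ℝ}

theorem log_one_add_inv_le (hβ : IsAdmissible β h) : Real.log (1 + 1 / β) ≤ h :=
  (Real.log_le_iff_le_exp (add_pos one_pos (one_div_pos.2 hβ.pos))).2 hβ.one_add_inv_le_exp

theorem delay_nonneg (hβ : IsAdmissible β h) : 0 ≤ h :=
  (Real.log_nonneg (le_add_of_nonneg_right (one_div_pos.2 hβ.pos).le)).trans hβ.log_one_add_inv_le

theorem mul_exp_log_sub (hβ : IsAdmissible β h) :
    β * Real.exp (Real.log (1 + 1 / β) - h) = (β + 1) * Real.exp (-h) := by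
  have hpos := hβ.pos
  rw [sub_eq_add_neg, Real.exp_add, Real.exp_log (by positivity)]
  field_simp

/-- The tangent line to `exp` at `log ((β ^ 2 + β) / (β ^ 2 + 1))` has slope
`(β ^ 2 + β) / (β ^ 2 + 1)`, so the left side is below it by the stability condition. -/
theorem lt_mul_exp (hβ : IsAdmissible β h) (r : ℝ) :
    (β ^ 2 + β) * (1 + r) - (β + 1) * Real.exp (-h) < (β ^ 2 + 1) * Real.exp r := by
  have hpos := hβ.pos
  have hq : 0 < (β ^ 2 + β) / (β ^ 2 + 1) := by positivity
  have htangent := Real.add_one_le_exp (r - Real.log ((β ^ 2 + β) / (β ^ 2 + 1)))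
  rw [Real.exp_sub, Real.exp_log hq] at htangent
  calc (β ^ 2 + β) * (1 + r) - (β + 1) * Real.exp (-h)
      = (β ^ 2 + β) * (r - 1 / β * Real.exp (-h) + 1) := by field_simp; ring
    _ < (β ^ 2 + β) * (Real.exp r / ((β ^ 2 + β) / (β ^ 2 + 1))) := by
        gcongr
        linarith [hβ.log_lt]
    _ = (β ^ 2 + 1) * Real.exp r := by field_simp

theorem log_one_add_inv (hβ : 0 < β) : IsAdmissible β (Real.log (1 + 1 / β)) where
  pos := hβ
  one_add_inv_le_exp := (Real.exp_log (by positivity)).ge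
  log_lt := by
    have hq : 0 < (β ^ 2 + β) / (β ^ 2 + 1) := by positivity
    calc Real.log ((β ^ 2 + β) / (β ^ 2 + 1)) ≤ (β ^ 2 + β) / (β ^ 2 + 1) - 1 :=
          Real.log_le_sub_one_of_pos hq
      _ < 1 / (β + 1) := by
          rw [div_sub_one (by positivity), div_lt_div_iff₀ (by positivity) (by positivity)]
          linarith
      _ = 1 / β * Real.exp (-Real.log (1 + 1 / β)) := by
          rw [Real.exp_neg, Real.exp_log (by positivity)]
          field_simp

theorem max_log (hβ : 0 < β)
    (hlt : Real.log ((β ^ 2 + β) / (β ^ 2 + 1)) < 1 / β * Real.exp (-h)) :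
    IsAdmissible β (max h (Real.log (1 + 1 / β))) := by
  have hlog := log_one_add_inv hβ
  refine ⟨hβ, hlog.one_add_inv_le_exp.trans (Real.exp_le_exp.2 (le_max_right _ _)), ?_⟩
  rcases max_choice h (Real.log (1 + 1 / β)) with hmax | hmax <;> rw [hmax]
  exacts [hlt, hlog.log_lt]

theorem max_one (hcond : β = 0 ∨ 1 / β * Real.exp (-h) > Real.log ((β ^ 2 + β) / (β ^ 2 + 1))) :
    IsAdmissible (max β 1) (max h (Real.log (1 + 1 / max β 1))) := by
  refine max_log (zero_lt_one.trans_le (le_max_right _ _)) ?_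
  rcases le_or_gt β 1 with hβ | hβ
  · rw [max_eq_right hβ, div_self (by norm_num), Real.log_one, div_one, one_mul]
    exact Real.exp_pos _
  · rw [max_eq_left hβ.le]
    exact hcond.resolve_left (by linarith)

theorem exists_perturbation (hβ : IsAdmissible β h) :
    ∃ ε b' h' β' : ℝ, 0 < ε ∧ ε < 1 ∧ β < b' ∧ h < h' ∧
      β' * (1 - ε) = b' * Real.exp (ε * h') ∧ IsAdmissible β' h' := by
  have hpos := hβ.pos
  set g : ℝ → ℝ := fun ε ↦ (β + ε) * Real.exp (ε * (h + ε)) / (1 - ε)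
  have hg0 : g 0 = β := by simp [g]
  have hg : ContinuousAt g 0 := ContinuousAt.div (by fun_prop) (by fun_prop) (by norm_num)
  have hlog : ∀ᶠ ε in 𝓝 (0 : ℝ),
      Real.log ((g ε ^ 2 + g ε) / (g ε ^ 2 + 1)) < 1 / g ε * Real.exp (-(h + ε)) := by
    refine ContinuousAt.eventually_lt ?_ ?_ (by simpa [hg0] using hβ.log_lt)
    · refine ContinuousAt.log (ContinuousAt.div (by fun_prop) (by fun_prop) (by positivity)) ?_
      rw [hg0]
      positivity
    · exact (ContinuousAt.div (by fun_prop) hg (hg0.trans_ne hpos.ne')).mul (by fun_prop)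
  obtain ⟨ε, ⟨hε, hε1⟩, hε0 : 0 < ε⟩ := (((hlog.and (eventually_lt_nhds one_pos)).filter_mono
    nhdsWithin_le_nhds).and (self_mem_nhdsWithin : Ioi (0 : ℝ) ∈ 𝓝[>] 0)).exists
  have hε1' : 0 < 1 - ε := sub_pos.2 hε1
  have hle : β ≤ g ε := by
    have hexp : 1 ≤ Real.exp (ε * (h + ε)) :=
      Real.one_le_exp (mul_nonneg hε0.le (add_nonneg hβ.delay_nonneg hε0.le))
    rw [le_div_iff₀ hε1']
    nlinarith
  refine ⟨ε, β + ε, h + ε, g ε, hε0, hε1, by linarith, by linarith, ?_, hpos.trans_le hle, ?_, hε⟩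
  · exact div_mul_cancel₀ _ hε1'.ne'
  · calc 1 + 1 / g ε ≤ 1 + 1 / β := by gcongr
      _ ≤ Real.exp h := hβ.one_add_inv_le_exp
      _ ≤ Real.exp (h + ε) := Real.exp_le_exp.2 (by linarith)

end IsAdmissible

/-- The upper Yorke condition `z' ≤ p (β sup (-z)⁺ - z)` on `[t₁, ∞)`, in which the supremum at `t`
extends over the window of all `u ≤ t` with `P t - h ≤ P u`. The supremum is encoded by quantifying
over the numbers `c ≥ 0` with `-c ≤ z` on the window. -/
structure YorkeUpper (P p : ℝ → ℝ) (β h t₁ : ℝ) (z : ℝ → ℝ) : Prop where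
  absolutelyContinuous : ∀ s t, t₁ ≤ s → s ≤ t → AbsolutelyContinuousOnInterval z s t
  deriv_le : ∀ᵐ t, t₁ ≤ t → ∃ z' : ℝ, HasDerivAt z z' t ∧
    ∀ c, 0 ≤ c → (∀ u ≤ t, P t - h ≤ P u → -c ≤ z u) → z' ≤ p t * (β * c - z t)

namespace YorkeUpper

variable {P p z : ℝ → ℝ} {β h t₁ s t u v w T c K : ℝ}

theorem exp_mul_le_of_neg_le (hz : YorkeUpper P p β h t₁ z) (hP : IsClock P p) (hs : t₁ ≤ s)
    (hst : s ≤ t) (hc : 0 ≤ c) (hlow : ∀ u ≤ t, P s - h < P u → -c ≤ z u) :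
    Real.exp (P t - P s) * z t ≤ z s + β * c * (Real.exp (P t - P s) - 1) := by
  have hvar := hP.exp_mul_le_add (c₀ := β * c) (c₁ := 0) hst (hz.absolutelyContinuous s t hs hst)
    (by
      filter_upwards [hz.deriv_le] with u hu hmem
      obtain ⟨z', hz', hle⟩ := hu (hs.trans hmem.1.le)
      refine ⟨z', hz', (hle c hc fun w hw hPw ↦ hlow w (hw.trans hmem.2.le) ?_).trans_eq (by ring)⟩
      linarith [hP.strictMono hmem.1])
  rwa [zero_mul, add_zero] at hvar

/-- After more than one window of positivity the delayed term no longer contributes. -/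
theorem lt_of_forall_pos (hz : YorkeUpper P p β h t₁ z) (hP : IsClock P p) (hh : 0 ≤ h)
    (hv : t₁ ≤ v) (hvT : v ≤ T) (hPT : P v + h < P T) (hpos : ∀ u ∈ Ioc v T, 0 < z u)
    (hK : 0 < K) (hup : ∀ u ≤ T, z u ≤ K) : z T < K := by
  obtain ⟨w, hw, hPw⟩ := hP.exists_eq (y := P v + h) hvT (by linarith) hPT.le
  have hdecay := hz.exp_mul_le_of_neg_le hP (hv.trans hw.1) hw.2 le_rfl fun u hu hPu ↦ by
    rw [neg_zero]
    exact (hpos u ⟨hP.strictMono.lt_iff_lt.1 (by linarith), hu⟩).le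
  rw [mul_zero, zero_mul, add_zero] at hdecay
  have hexp : 1 < Real.exp (P T - P w) := Real.one_lt_exp_iff.2 (by linarith)
  refine lt_of_mul_lt_mul_left ?_ (Real.exp_pos (P T - P w)).le
  calc Real.exp (P T - P w) * z T ≤ K := hdecay.trans (hup w hw.2)
    _ < Real.exp (P T - P w) * K := lt_mul_of_one_lt_left hK hexp

theorem neg_mul_le_of_le_of_eq_zero (hz : YorkeUpper P p β h t₁ z) (hP : IsClock P p)
    (hzv : z v = 0) (hu : t₁ ≤ u) (huv : u ≤ v) (hK : 0 ≤ K) (hlow : ∀ s ≤ v, -K ≤ z s) :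
    -(β * K * (Real.exp (P v - P u) - 1)) ≤ z u := by
  have hle := hz.exp_mul_le_of_neg_le hP hu huv hK fun s hs _ ↦ hlow s hs
  rw [hzv, mul_zero] at hle
  linarith

theorem neg_mul_le_of_mem_window (hz : YorkeUpper P p β h t₁ z) (hP : IsClock P p) (hβ : 0 ≤ β)
    (hzv : z v = 0) (hv : P t₁ + h ≤ P v) (hvs : v ≤ s) (hPs : P s ≤ P v + h)
    (hpos : ∀ u ∈ Ioc v s, 0 < z u) (hK : 0 ≤ K) (hlow : ∀ u ≤ v, -K ≤ z u)
    (hus : u ≤ s) (hPu : P s - h ≤ P u) :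
    -(β * K * (Real.exp (P v + h - P s) - 1)) ≤ z u := by
  rcases le_or_gt u v with huv | huv
  · have hPvs := hP.strictMono.monotone hvs
    have hu : t₁ ≤ u := hP.strictMono.le_iff_le.1 (by linarith)
    have hexp : Real.exp (P v - P u) ≤ Real.exp (P v + h - P s) :=
      Real.exp_le_exp.2 (by linarith)
    linear_combination hz.neg_mul_le_of_le_of_eq_zero hP hzv hu huv hK hlow + β * K * hexp
  · have hexp : 1 ≤ Real.exp (P v + h - P s) := Real.one_le_exp (by linarith)
    have hnonneg : 0 ≤ β * K * (Real.exp (P v + h - P s) - 1) :=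
      mul_nonneg (mul_nonneg hβ hK) (by linarith)
    linarith [hpos u ⟨huv, hus⟩]

theorem exp_mul_le_of_eq_zero (hz : YorkeUpper P p β h t₁ z) (hP : IsClock P p) (hβ : 0 ≤ β)
    (hzv : z v = 0) (ht₁ : t₁ ≤ v) (hv : P t₁ + h ≤ P v) (hvw : v ≤ w) (hwT : w ≤ T)
    (hPT : P T ≤ P v + h) (hpos : ∀ u ∈ Ioc v T, 0 < z u) (hK : 0 ≤ K)
    (hlow : ∀ u ≤ v, -K ≤ z u) :
    Real.exp (P T - P w) * z T ≤ z w - β ^ 2 * K * (Real.exp (P T - P w) - 1)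
      + β ^ 2 * K * Real.exp (P v + h - P w) * (P T - P w) := by
  have hvar := hP.exp_mul_le_add (c₀ := -(β ^ 2 * K))
    (c₁ := β ^ 2 * K * Real.exp (P v + h - P w)) hwT
    (hz.absolutelyContinuous w T (ht₁.trans hvw) hwT) (by
      filter_upwards [hz.deriv_le] with s hs hmem
      have hvs := hvw.trans hmem.1.le
      have hPs : P s ≤ P v + h := (hP.strictMono.monotone hmem.2.le).trans hPT
      have hexp : 1 ≤ Real.exp (P v + h - P s) := Real.one_le_exp (by linarith)
      obtain ⟨z', hz', hle⟩ := hs (ht₁.trans hvs)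
      refine ⟨z', hz', (hle (β * K * (Real.exp (P v + h - P s) - 1))
        (mul_nonneg (mul_nonneg hβ hK) (by linarith)) fun u hus hPu ↦
          hz.neg_mul_le_of_mem_window hP hβ hzv hv hvs hPs
            (fun u hu ↦ hpos u ⟨hu.1, hu.2.trans hmem.2.le⟩) hK hlow hus hPu).trans_eq ?_⟩
      rw [mul_assoc _ (Real.exp (P v + h - P w)), ← Real.exp_add, sub_add_sub_cancel]
      ring)
  linarith

theorem le_mul_of_eq_zero (hz : YorkeUpper P p β h t₁ z) (hP : IsClock P p)
    (hβ : IsAdmissible β h) (hzv : z v = 0) (ht₁ : t₁ ≤ v) (hvw : v ≤ w)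
    (hPw : P w ≤ P v + h - Real.log (1 + 1 / β)) (hK : 0 ≤ K) (hlow : ∀ u ≤ w, -K ≤ z u) :
    z w ≤ K * (β - (β + 1) * Real.exp (-h)) := by
  have hβ0 := hβ.pos
  have hle := hz.exp_mul_le_of_neg_le hP ht₁ hvw hK fun u hu _ ↦ hlow u hu
  rw [hzv, zero_add] at hle
  refine le_of_mul_le_mul_left (hle.trans ?_) (Real.exp_pos (P w - P v))
  have hexp : Real.exp (P w - P v) * Real.exp (Real.log (1 + 1 / β) - h) ≤ 1 := by
    rw [← Real.exp_add]
    exact Real.exp_le_one_iff.2 (by linarith)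
  rw [← hβ.mul_exp_log_sub]
  linear_combination β * K * hexp

theorem lt_of_last_zero (hz : YorkeUpper P p β h t₁ z) (hP : IsClock P p)
    (hβ : IsAdmissible β h) (hzv : z v = 0) (hv : P t₁ + h ≤ P v) (hvT : v ≤ T)
    (hPT : P T ≤ P v + h) (hpos : ∀ u ∈ Ioc v T, 0 < z u) (hK : 0 < K)
    (hlow : ∀ u ≤ T, -K ≤ z u) : z T < K := by
  have hβ0 := hβ.pos
  have hl := hβ.log_one_add_inv_le
  have ht₁ : t₁ ≤ v := hP.strictMono.le_iff_le.1 (by linarith [hβ.delay_nonneg])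
  -- At `P v + h - log (1 + 1 / β)` the two bounds on the delayed term, the constant `K` and the one
  -- obtained by going back from `v`, coincide.
  rcases le_total (P T) (P v + h - Real.log (1 + 1 / β)) with hcase | hcase
  · have hlt := hβ.lt_mul_exp 0
    rw [add_zero, Real.exp_zero] at hlt
    refine (hz.le_mul_of_eq_zero hP hβ hzv ht₁ hvT hcase hK.le hlow).trans_lt
      (mul_lt_of_lt_one_right hK ?_)
    linarith
  · obtain ⟨w, ⟨hvw, hwT⟩, hPw⟩ := hP.exists_eq (y := P v + h - Real.log (1 + 1 / β)) hvT
      (by linarith) hcase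
    have hstart := hz.le_mul_of_eq_zero hP hβ hzv ht₁ hvw hPw.le hK.le
      fun u hu ↦ hlow u (hu.trans hwT)
    have hend := hz.exp_mul_le_of_eq_zero hP hβ0.le hzv ht₁ hv hvw hwT hPT hpos hK.le
      fun u hu ↦ hlow u (hu.trans hvT)
    have hexp : Real.exp (P v + h - P w) = 1 + 1 / β := by
      rw [hPw, sub_sub_cancel, Real.exp_log (by positivity)]
    rw [hexp] at hend
    set r := P T - P w
    refine lt_of_mul_lt_mul_left ?_ (Real.exp_pos r).le
    calc Real.exp r * z T ≤ K * (β - (β + 1) * Real.exp (-h)) - β ^ 2 * K * (Real.exp r - 1)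
          + β ^ 2 * K * (1 + 1 / β) * r := by linarith
      _ = K * ((β ^ 2 + β) * (1 + r) - (β + 1) * Real.exp (-h) - β ^ 2 * Real.exp r) := by
          field_simp
          ring
      _ < K * Real.exp r := by
          gcongr
          linarith [hβ.lt_mul_exp r]
      _ = Real.exp r * K := mul_comm _ _

theorem lt_of_abs_le (hz : YorkeUpper P p β h t₁ z) (hP : IsClock P p) (hβ : IsAdmissible β h)
    (hPT : P t₁ + 2 * h < P T) (hK : 0 < K) (hbd : ∀ u ≤ T, |z u| ≤ K) : z T < K := by
  have hh := hβ.delay_nonneg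
  rcases le_or_gt (z T) 0 with hzT | hzT
  · exact hzT.trans_lt hK
  have ht₁ : t₁ ≤ T := hP.strictMono.le_iff_le.1 (by linarith)
  obtain ⟨t₂, ht₂, hPt₂⟩ := hP.exists_eq (y := P t₁ + h) ht₁ (by linarith) (by linarith)
  have hcont := (hz.absolutelyContinuous t₂ T ht₂.1 ht₂.2).continuousOn
  rw [uIcc_of_le ht₂.2] at hcont
  have hup : ∀ u ≤ T, z u ≤ K := fun u hu ↦ (abs_le.1 (hbd u hu)).2
  rcases exists_last_zero_or_forall_pos hcont hzT with ⟨v, hv, hzv, hpos⟩ | hpos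
  · rcases lt_or_ge (P v + h) (P T) with hPv | hPv
    · exact hz.lt_of_forall_pos hP hh (ht₂.1.trans hv.1) hv.2.le hPv hpos hK hup
    · exact hz.lt_of_last_zero hP hβ hzv (hPt₂.symm.le.trans (hP.strictMono.monotone hv.1))
        hv.2.le hPv hpos hK fun u hu ↦ (abs_le.1 (hbd u hu)).1
  · exact hz.lt_of_forall_pos hP hh ht₂.1 ht₂.2 (by linarith)
      (fun u hu ↦ hpos u (Ioc_subset_Icc_self hu)) hK hup

theorem abs_le_of_forall_abs_le {N t₂ : ℝ} (hz : YorkeUpper P p β h t₁ z)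
    (hz' : YorkeUpper P p β h t₁ (-z)) (hP : IsClock P p) (hβ : IsAdmissible β h)
    (ht₂ : P t₁ + 2 * h ≤ P t₂) (hbd : ∀ u ≤ t₂, |z u| ≤ N) (ht : t₂ ≤ t) : |z t| ≤ N := by
  have h₁₂ : t₁ ≤ t₂ := hP.strictMono.le_iff_le.1 (by linarith [hβ.delay_nonneg])
  have hcont := (hz.absolutelyContinuous t₂ t h₁₂ ht).continuousOn
  rw [uIcc_of_le ht] at hcont
  refine abs_le_of_forall_abs_lt ht hcont (hbd t₂ le_rfl) fun K hK T hT hle ↦ ?_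
  have hK0 : 0 < K := (abs_nonneg _).trans_lt ((hbd t₂ le_rfl).trans_lt hK)
  have hPT : P t₁ + 2 * h < P T := ht₂.trans_lt (hP.strictMono hT.1)
  have hall : ∀ u ≤ T, |z u| ≤ K := fun u hu ↦
    (le_total u t₂).elim (fun hut₂ ↦ (hbd u hut₂).trans hK.le) fun ht₂u ↦ hle u ⟨ht₂u, hu⟩
  refine abs_lt.2 ⟨neg_lt.1 ?_, hz.lt_of_abs_le hP hβ hPT hK0 hall⟩
  exact hz'.lt_of_abs_le hP hβ hPT hK0 fun u hu ↦ (abs_neg (z u)).trans_le (hall u hu)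

end YorkeUpper

theorem le_setIntegral_of_forall_le {X : Type*} [TopologicalSpace X] [T2Space X]
    [SecondCountableTopology X] [MeasurableSpace X] [OpensMeasurableSpace X] {ν : Measure X}
    {s : Set X} (hs : IsCompact s) (hν : ν s = 1) {f : X → ℝ} (hf : ContinuousOn f s) {c : ℝ}
    (hc : ∀ u ∈ s, c ≤ f u) : c ≤ ∫ u in s, f u ∂ν := by
  obtain ⟨C, hC⟩ := hs.exists_bound_of_continuousOn hf
  have hint : IntegrableOn f s ν := IntegrableOn.of_bound (hν.trans_lt ENNReal.one_lt_top)
    (hf.aestronglyMeasurable hs.measurableSet) C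
    ((ae_restrict_iff' hs.measurableSet).2 (ae_of_all _ hC))
  have hle := setIntegral_ge_of_const_le hs.measurableSet (hν.trans_ne ENNReal.one_ne_top) hc hint
  rwa [measureReal_def, hν, ENNReal.toReal_one, one_smul] at hle

namespace IsSolution

variable {m : ℕ} {a : ℝ → ℝ} {b h : Fin m → ℝ → ℝ} {R : Fin m → ℝ → ℝ → ℝ} {t₀ : ℝ}
  {φ : Iic t₀ →ᵇ ℝ} {x : ℝ → ℝ}

theorem neg (hx : IsSolution a b h R t₀ φ x) : IsSolution a b h R t₀ (-φ) (-x) where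
  initial s := congrArg Neg.neg (hx.initial s)
  absolutelyContinuous T hT := (hx.absolutelyContinuous T hT).neg
  equation := by
    filter_upwards [hx.equation] with t ⟨x', hx', heq⟩
    refine ⟨-x', hx'.neg, ?_⟩
    simp only [Pi.neg_apply, integral_neg, mul_neg, Finset.sum_neg_distrib]
    linarith

theorem continuous (hx : IsSolution a b h R t₀ φ x) : Continuous x := by
  have hinit : ContinuousOn x (Iic t₀) := by
    rw [continuousOn_iff_continuous_domRestrict]
    convert φ.continuous using 1
    exact funext hx.initial
  have hsol : ContinuousOn x (Ici t₀) := by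
    intro t ht
    have hle : t₀ ≤ t + 1 := le_add_of_le_of_nonneg ht zero_le_one
    have hcont := (hx.absolutelyContinuous (t + 1) hle).continuousOn
    rw [uIcc_of_le hle] at hcont
    refine (hcont t ⟨ht, by linarith⟩).mono_of_mem_nhdsWithin ?_
    rw [← Ici_inter_Iic]
    exact inter_mem self_mem_nhdsWithin (mem_nhdsWithin_of_mem_nhds (Iic_mem_nhds (by linarith)))
  rw [← continuousOn_univ, ← Iic_union_Ici (a := t₀)]
  exact hinit.union_of_isClosed hsol isClosed_Iic isClosed_Ici

theorem abs_le_norm (hx : IsSolution a b h R t₀ φ x) {t : ℝ} (ht : t ≤ t₀) : |x t| ≤ ‖φ‖ := by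
  have hle := φ.norm_coe_le_norm ⟨t, ht⟩
  rwa [← hx.initial] at hle

variable (hx : IsSolution a b h R t₀ φ x) (ht₀ : 0 ≤ t₀)
  (hb_nonneg : ∀ k t, 0 ≤ t → 0 ≤ b k t)
  (hR_mass : ∀ k, ∀ᵐ t ∂(volume.restrict (Ici 0)),
    stieltjesMeasure (R k t) (Icc (h k t) t) = 1)

include hx ht₀ hb_nonneg hR_mass

theorem ae_deriv_le : ∀ᵐ t, t₀ ≤ t → ∃ x' : ℝ, HasDerivAt x x' t ∧
    ∀ c, (∀ k, ∀ u ∈ Icc (h k t) t, -c ≤ x u) → x' ≤ (∑ k, b k t) * c - a t * x t := by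
  filter_upwards [(ae_restrict_iff' measurableSet_Ici).1 hx.equation,
    (ae_restrict_iff' measurableSet_Ici).1 (ae_all_iff.2 hR_mass)] with t hequation hmass ht
  have ht0 : 0 ≤ t := ht₀.trans ht
  obtain ⟨x', hx', heq⟩ := hequation ht
  refine ⟨x', hx', fun c hc ↦ ?_⟩
  have hsum : ∑ k, b k t * -c
      ≤ ∑ k, b k t * ∫ s in Icc (h k t) t, x s ∂(stieltjesMeasure (R k t)) :=
    Finset.sum_le_sum fun k _ ↦ mul_le_mul_of_nonneg_left
      (le_setIntegral_of_forall_le isCompact_Icc (hmass ht0 k) hx.continuous.continuousOn (hc k))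
      (hb_nonneg k t ht0)
  rw [← Finset.sum_mul] at hsum
  linarith

section Growth

variable {G g : ℝ → ℝ} (hG : IsClock G g) (hg : ∀ t, t₀ ≤ t → |a t| + ∑ k, b k t ≤ g t)

include hG hg

theorem lt_mul_exp {K T : ℝ} (hK : ‖φ‖ < K) (hT : t₀ ≤ T)
    (hbd : ∀ u ∈ Icc t₀ T, |x u| ≤ K * Real.exp (G u - G t₀)) :
    x T < K * Real.exp (G T - G t₀) := by
  have hK0 : 0 < K := (norm_nonneg φ).trans_lt hK
  have hexp : AbsolutelyContinuousOnInterval (fun u ↦ K * Real.exp (G u - G t₀)) t₀ T :=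
    (absolutelyContinuousOnInterval_exp ((hG.absolutelyContinuous t₀ T).sub
      contDiff_const.contDiffOn.absolutelyContinuousOnInterval)).const_mul K
  have hmono := le_of_ae_deriv_nonpos hT ((hx.absolutelyContinuous T hT).sub hexp) (by
    filter_upwards [hx.ae_deriv_le ht₀ hb_nonneg hR_mass, hG.ae_hasDerivAt] with t hderiv hGt ht
    have ht₀t := ht.1.le
    obtain ⟨x', hx', hle⟩ := hderiv ht₀t
    refine ⟨_, hx'.sub ((hGt.sub_const (G t₀)).exp.const_mul K), ?_⟩
    set c := K * Real.exp (G t - G t₀)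
    have hpast : ∀ u ≤ t, |x u| ≤ c := fun u hu ↦ by
      rcases le_total u t₀ with hut₀ | hut₀
      · have hone : 1 ≤ Real.exp (G t - G t₀) :=
          Real.one_le_exp (sub_nonneg.2 (hG.strictMono.monotone ht₀t))
        exact (hx.abs_le_norm hut₀).trans (hK.le.trans (le_mul_of_one_le_right hK0.le hone))
      · refine (hbd u ⟨hut₀, hu.trans ht.2.le⟩).trans ?_
        exact mul_le_mul_of_nonneg_left (Real.exp_le_exp.2
          (sub_le_sub_right (hG.strictMono.monotone hu) _)) hK0.le
    have hc : 0 ≤ c := (abs_nonneg _).trans (hpast t le_rfl)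
    have hax : -(a t * x t) ≤ |a t| * c := by
      refine (neg_le_abs _).trans ?_
      rw [abs_mul]
      exact mul_le_mul_of_nonneg_left (hpast t le_rfl) (abs_nonneg _)
    have hgc := mul_le_mul_of_nonneg_right (hg t ht₀t) hc
    have hx'c := hle c fun k u hu ↦ (abs_le.1 (hpast u hu.2)).1
    linarith)
  have hinit := (le_abs_self _).trans (hx.abs_le_norm le_rfl)
  simp only [Pi.sub_apply, sub_self, Real.exp_zero, mul_one] at hmono
  linarith

theorem abs_le_mul_exp {t : ℝ} (ht : t₀ ≤ t) : |x t| ≤ ‖φ‖ * Real.exp (G t - G t₀) := by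
  have habs : ∀ u, |x u / Real.exp (G u - G t₀)| = |x u| / Real.exp (G u - G t₀) := fun u ↦ by
    rw [abs_div, Real.abs_exp]
  have hcont : ContinuousOn (fun u ↦ x u / Real.exp (G u - G t₀)) (Icc t₀ t) :=
    (hx.continuous.div (hG.continuous.sub continuous_const).rexp
      fun u ↦ (Real.exp_pos _).ne').continuousOn
  have hinit : |x t₀ / Real.exp (G t₀ - G t₀)| ≤ ‖φ‖ := by
    rw [sub_self, Real.exp_zero, div_one]
    exact hx.abs_le_norm le_rfl
  have hle := abs_le_of_forall_abs_lt ht hcont hinit fun K hK T hT hbd ↦ by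
    simp only [habs, div_le_iff₀ (Real.exp_pos _), div_lt_iff₀ (Real.exp_pos _)] at hbd ⊢
    refine abs_lt.2 ⟨neg_lt.1 ?_, hx.lt_mul_exp ht₀ hb_nonneg hR_mass hG hg hK hT.1.le hbd⟩
    exact hx.neg.lt_mul_exp ht₀ hb_nonneg hR_mass hG hg (by rwa [norm_neg]) hT.1.le
      fun u hu ↦ (abs_neg (x u)).trans_le (hbd u hu)
  rwa [habs, div_le_iff₀ (Real.exp_pos _)] at hle

end Growth

variable {A α : ℝ → ℝ} (hA : IsClock A α) (hα : EqOn α a (Ici 0)) {ε b' h' β' t₁ : ℝ}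
  (hε0 : 0 ≤ ε) (hβ' : β' * (1 - ε) = b' * Real.exp (ε * h')) (ht₁ : t₀ ≤ t₁)
  (hAh : ∀ t, t₁ ≤ t → ∀ k, A t - A (h k t) ≤ h')
  (hba : ∀ t, t₁ ≤ t → ∑ k, b k t ≤ b' * a t)

include hA hα hε0 hβ' ht₁ hAh hba

theorem yorkeUpper : YorkeUpper (fun t ↦ (1 - ε) * A t) (fun t ↦ (1 - ε) * α t) β' h' t₁
    (fun t ↦ Real.exp (ε * A t) * x t) where
  absolutelyContinuous s t hs hst := by
    have hs₀ := ht₁.trans hs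
    refine (absolutelyContinuousOnInterval_exp
      ((hA.absolutelyContinuous s t).const_mul ε)).mul
      ((hx.absolutelyContinuous t (hs₀.trans hst)).mono ?_)
    rw [uIcc_of_le hst, uIcc_of_le (hs₀.trans hst)]
    exact Icc_subset_Icc_left hs₀
  deriv_le := by
    filter_upwards [hx.ae_deriv_le ht₀ hb_nonneg hR_mass, hA.ae_hasDerivAt] with t hderiv hAt ht
    obtain ⟨x', hx', hle⟩ := hderiv (ht₁.trans ht)
    refine ⟨_, (hAt.const_mul ε).exp.mul hx', fun c hc hwindow ↦ ?_⟩
    set D := c * Real.exp (ε * (h' - A t))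
    have hD : Real.exp (ε * A t) * D = c * Real.exp (ε * h') := by
      rw [mul_left_comm, ← Real.exp_add, ← mul_add, add_sub_cancel]
    have hxD : ∀ k, ∀ u ∈ Icc (h k t) t, -D ≤ x u := fun k u hu ↦ by
      have hAu : A t - A u ≤ h' :=
        (sub_le_sub_left (hA.strictMono.monotone hu.1) _).trans (hAh t ht k)
      have hAu0 : 0 ≤ A t - A u := sub_nonneg.2 (hA.strictMono.monotone hu.2)
      have hzu := hwindow u hu.2 (by linarith [mul_nonneg hε0 hAu0])
      have hexp : 1 ≤ Real.exp (ε * A u) * Real.exp (ε * (h' - A t)) := by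
        rw [← Real.exp_add, ← mul_add]
        exact Real.one_le_exp (mul_nonneg hε0 (by linarith))
      refine le_of_mul_le_mul_left ?_ (Real.exp_pos (ε * A u))
      linear_combination hzu + c * hexp
    have ha : α t = a t := hα (ht₀.trans (ht₁.trans ht))
    have hD0 : 0 ≤ D := mul_nonneg hc (Real.exp_pos _).le
    calc Real.exp (ε * A t) * (ε * α t) * x t + Real.exp (ε * A t) * x'
        ≤ Real.exp (ε * A t) * (ε * α t) * x t
          + Real.exp (ε * A t) * (b' * a t * D - a t * x t) := by
          gcongr
          exact (hle D hxD).trans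
            (sub_le_sub_right (mul_le_mul_of_nonneg_right (hba t ht) hD0) _)
      _ = α t * (b' * (Real.exp (ε * A t) * D)
          - (1 - ε) * (Real.exp (ε * A t) * x t)) := by rw [ha]; ring
      _ = (1 - ε) * α t * (β' * c - Real.exp (ε * A t) * x t) := by
          linear_combination α t * b' * hD - α t * c * hβ'

theorem abs_le_mul_exp_of_isAdmissible {G g : ℝ → ℝ} (hG : IsClock G g)
    (hg : ∀ t, t₀ ≤ t → |a t| + ∑ k, b k t ≤ g t) (hadm : IsAdmissible β' h') (hε1 : ε < 1)
    {t₂ t : ℝ} (ht₂ : t₁ ≤ t₂) (hA₂ : 2 * h' ≤ (1 - ε) * (A t₂ - A t₁)) :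
    |x t| ≤ ‖φ‖ * Real.exp (G t₂ - G t₀ + ε * (A t₂ - A t)) := by
  have ht₀₂ : t₀ ≤ t₂ := ht₁.trans ht₂
  have hgrowth : ∀ u ≤ t₂, |x u| ≤ ‖φ‖ * Real.exp (G t₂ - G t₀) := fun u hu ↦ by
    rcases le_total u t₀ with hut₀ | hut₀
    · exact (hx.abs_le_norm hut₀).trans (le_mul_of_one_le_right (norm_nonneg _)
        (Real.one_le_exp (sub_nonneg.2 (hG.strictMono.monotone ht₀₂))))
    · refine (hx.abs_le_mul_exp ht₀ hb_nonneg hR_mass hG hg hut₀).trans ?_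
      gcongr
      exact hG.strictMono.monotone hu
  have hz : ∀ u ≤ t₂, |Real.exp (ε * A u) * x u|
      ≤ Real.exp (ε * A t₂) * (‖φ‖ * Real.exp (G t₂ - G t₀)) := fun u hu ↦ by
    rw [abs_mul, Real.abs_exp]
    gcongr
    exacts [hA.strictMono.monotone hu, hgrowth u hu]
  have hzt : |Real.exp (ε * A t) * x t|
      ≤ Real.exp (ε * A t₂) * (‖φ‖ * Real.exp (G t₂ - G t₀)) := by
    rcases le_total t t₂ with htt₂ | htt₂
    · exact hz t htt₂
    have hupper := hx.yorkeUpper ht₀ hb_nonneg hR_mass hA hα hε0 hβ' ht₁ hAh hba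
    have hlower := hx.neg.yorkeUpper ht₀ hb_nonneg hR_mass hA hα hε0 hβ' ht₁ hAh hba
    simp only [Pi.neg_apply, mul_neg] at hlower
    exact hupper.abs_le_of_forall_abs_le hlower (hA.const_mul (sub_pos.2 hε1)) hadm
      (by linarith) hz htt₂
  rw [abs_mul, Real.abs_exp] at hzt
  refine le_of_mul_le_mul_left (hzt.trans_eq ?_) (Real.exp_pos (ε * A t))
  rw [mul_left_comm, mul_left_comm (Real.exp _), ← Real.exp_add, ← Real.exp_add]
  ring_nf

end IsSolution

theorem exponentiallyStable_of_isAdmissible {m : ℕ} {a : ℝ → ℝ} {b h : Fin m → ℝ → ℝ}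
    {R : Fin m → ℝ → ℝ → ℝ} {A α G g : ℝ → ℝ} {a₀ ε b' h' β' T : ℝ}
    (ha₀ : 0 < a₀) (ha_ge : ∀ t, 0 ≤ t → a₀ ≤ a t) (hb_nonneg : ∀ k t, 0 ≤ t → 0 ≤ b k t)
    (hR_mass : ∀ k, ∀ᵐ t ∂(volume.restrict (Ici 0)),
      stieltjesMeasure (R k t) (Icc (h k t) t) = 1)
    (hA : IsClock A α) (hα : EqOn α a (Ici 0))
    (hG : IsClock G g) (hg : EqOn g (fun t ↦ a t + ∑ k, b k t) (Ici 0))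
    (hε0 : 0 < ε) (hε1 : ε < 1) (hβ' : β' * (1 - ε) = b' * Real.exp (ε * h'))
    (hadm : IsAdmissible β' h') (hT : 0 ≤ T) (hAh : ∀ t, T ≤ t → ∀ k, A t - A (h k t) ≤ h')
    (hba : ∀ t, T ≤ t → ∑ k, b k t ≤ b' * a t) : ExponentiallyStable a b h R := by
  have hε1' : 0 < 1 - ε := sub_pos.2 hε1
  set ℓ := 2 * h' / (1 - ε)
  have hℓ : 0 ≤ ℓ := div_nonneg (mul_nonneg two_pos.le hadm.delay_nonneg) hε1'.le
  refine ⟨Real.exp (G T - G 0 + (1 + b') * ℓ + ε * (A T - A 0 + ℓ)), Real.exp_pos _, ε * a₀,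
    mul_pos hε0 ha₀, fun t₀ ht₀ φ x hx t ht ↦ ?_⟩
  set τ := max t₀ T
  have ht₀τ : t₀ ≤ τ := le_max_left _ _
  have hTτ : T ≤ τ := le_max_right _ _
  have hα_ge : ∀ u, 0 ≤ u → a₀ ≤ α u := fun u hu ↦ (ha_ge u hu).trans_eq (hα hu).symm
  obtain ⟨t₂, hτt₂, hAt₂⟩ := hA.exists_eq_add (s := τ) ha₀
    (fun u hu ↦ hα_ge u (ht₀.trans (ht₀τ.trans hu))) hℓ
  have hgrowth : ∀ u, t₀ ≤ u → |a u| + ∑ k, b k u ≤ g u := fun u hu ↦ by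
    have hu0 : 0 ≤ u := ht₀.trans hu
    rw [abs_of_nonneg (ha₀.le.trans (ha_ge u hu0)), hg hu0]
  have hAℓ : 2 * h' ≤ (1 - ε) * (A t₂ - A τ) := by
    rw [hAt₂, add_sub_cancel_left, mul_div_cancel₀ _ hε1'.ne']
  have hxt : |x t| ≤ ‖φ‖ * Real.exp (G t₂ - G t₀ + ε * (A t₂ - A t)) :=
    hx.abs_le_mul_exp_of_isAdmissible ht₀ hb_nonneg hR_mass hA hα hε0.le hβ' ht₀τ
      (fun u hu ↦ hAh u (hTτ.trans hu)) (fun u hu ↦ hba u (hTτ.trans hu)) hG hgrowth hadm hε1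
      hτt₂ hAℓ
  have hGt₂ : G t₂ - G τ ≤ (1 + b') * (A t₂ - A τ) := hA.sub_le_mul_sub hG hτt₂ fun u hu ↦ by
    have hu0 : u ∈ Ici 0 := ht₀.trans (ht₀τ.trans hu.1)
    rw [hg hu0, hα hu0]
    linarith [hba u (hTτ.trans hu.1)]
  have hAt : a₀ * (t - t₀) ≤ A t - A t₀ := hA.mul_sub_le ht fun u hu ↦ hα_ge u (ht₀.trans hu.1)
  have hGτ : G τ - G t₀ ≤ G T - G 0 := hG.max_sub_le ht₀ hT
  have hAτ : A τ - A t₀ ≤ A T - A 0 := hA.max_sub_le ht₀ hT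
  rw [hAt₂, add_sub_cancel_left] at hGt₂
  have hexponent : G t₂ - G t₀ + ε * (A t₂ - A t) ≤ G T - G 0 + (1 + b') * ℓ
      + ε * (A T - A 0 + ℓ) + -(ε * a₀) * (t - t₀) := by
    linear_combination hGt₂ + hGτ + ε * hAt₂ + ε * hAτ + ε * hAt
  refine hxt.trans ?_
  rw [mul_comm _ ‖φ‖, mul_assoc, ← Real.exp_add]
  gcongr

theorem eventually_clock_sub_le {ι : Type*} [Finite ι] [Nonempty ι] {a A α : ℝ → ℝ}
    {h : ι → ℝ → ℝ} {h₀ h' : ℝ} (hA : IsClock A α) (hα : EqOn α a (Ici 0))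
    (hh : ∀ k, ∀ᶠ t in atTop, 0 ≤ h k t)
    (hlim : limsup (fun t ↦ ((∫ s in (⨅ k, h k t)..t, a s : ℝ) : EReal)) atTop = (h₀ : EReal))
    (hlt : h₀ < h') : ∀ᶠ t in atTop, ∀ k, A t - A (h k t) ≤ h' := by
  filter_upwards [eventually_lt_of_limsup_lt (hlim.trans_lt (EReal.coe_lt_coe_iff.2 hlt)),
    eventually_all.2 hh, eventually_ge_atTop 0] with t hint hht ht k
  obtain ⟨j, hj⟩ := exists_eq_ciInf_of_finite (f := fun k ↦ h k t)
  have hjk : h j t ≤ h k t := hj.trans_le (ciInf_le (finite_range _).bddBelow k)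
  have hsub : uIcc (h j t) t ⊆ Ici 0 := fun u hu ↦ (le_min (hht j) ht).trans hu.1
  rw [EReal.coe_lt_coe_iff, ← hj,
    ← intervalIntegral.integral_congr (hα.mono hsub), hA.integral_eq_sub] at hint
  exact (sub_le_sub_left (hA.strictMono.monotone hjk) _).trans hint.le

theorem eventually_le_mul_of_limsup_div {ι : Type*} {l : Filter ι} {f g : ι → ℝ} {c c' : ℝ}
    (hg : ∀ᶠ t in l, 0 < g t) (hlim : limsup (fun t ↦ ((f t / g t : ℝ) : EReal)) l = (c : EReal))
    (hlt : c < c') : ∀ᶠ t in l, f t ≤ c' * g t := by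
  filter_upwards [eventually_lt_of_limsup_lt (hlim.trans_lt (EReal.coe_lt_coe_iff.2 hlt)), hg]
    with t ht hgt
  exact ((div_lt_iff₀ hgt).1 (EReal.coe_lt_coe_iff.1 ht)).le

theorem theorem4_general (m : ℕ) (hm : 0 < m)
    (a : ℝ → ℝ) (b h : Fin m → ℝ → ℝ) (R : Fin m → ℝ → ℝ → ℝ)
    (ha : LocallyIntegrableOn a (Ici 0)) (hb : ∀ k, LocallyIntegrableOn (b k) (Ici 0))
    (a₀ : ℝ) (ha₀ : 0 < a₀) (ha_ge : ∀ t, 0 ≤ t → a₀ ≤ a t)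
    (hb_nonneg : ∀ k t, 0 ≤ t → 0 ≤ b k t)
    (hh : ∀ k, ∀ᶠ t in atTop, 0 ≤ h k t)
    (hR_mass : ∀ k, ∀ᵐ t ∂(volume.restrict (Ici 0)),
      stieltjesMeasure (R k t) (Icc (h k t) t) = 1)
    (h₀ β : ℝ)
    (hh₀ : limsup (fun t : ℝ => ((∫ s in (⨅ k, h k t)..t, a s : ℝ) : EReal)) atTop = (h₀ : EReal))
    (hβ : limsup (fun t : ℝ => (((∑ k, b k t) / a t : ℝ) : EReal)) atTop = (β : EReal))
    (hcond : β = 0 ∨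
      1 / β * Real.exp (-h₀) > Real.log ((β ^ 2 + β) / (β ^ 2 + 1))) :
    ExponentiallyStable a b h R := by
  have : Nonempty (Fin m) := ⟨⟨0, hm⟩⟩
  have ha_pos : ∀ t, 0 ≤ t → 0 < a t := fun t ht ↦ ha₀.trans_le (ha_ge t ht)
  obtain ⟨A, α, hA, hα⟩ := exists_isClock_eqOn ha ha_pos
  have hsum : LocallyIntegrableOn (fun t ↦ a t + ∑ k, b k t) (Ici 0) :=
    (locallyIntegrableOn_iff isClosed_Ici.isLocallyClosed).2 fun K hK hKc ↦
      (ha.integrableOn_compact_subset hK hKc).add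
        (integrable_finsetSum _ fun k _ ↦ (hb k).integrableOn_compact_subset hK hKc)
  obtain ⟨G, g, hG, hg⟩ := exists_isClock_eqOn hsum fun t ht ↦
    add_pos_of_pos_of_nonneg (ha_pos t ht) (Finset.sum_nonneg fun k _ ↦ hb_nonneg k t ht)
  obtain ⟨ε, b', h', β', hε0, hε1, hβb', hh', hβ', hadm⟩ :=
    (IsAdmissible.max_one hcond).exists_perturbation
  have hAh := eventually_clock_sub_le hA hα hh hh₀ ((le_max_left _ _).trans_lt hh')
  have hba := eventually_le_mul_of_limsup_div ((eventually_ge_atTop 0).mono ha_pos) hβ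
    ((le_max_left _ _).trans_lt hβb')
  obtain ⟨T, hT⟩ := ((hAh.and hba).and (eventually_ge_atTop 0)).exists_forall_of_atTop
  exact exponentiallyStable_of_isAdmissible ha₀ ha_ge hb_nonneg hR_mass hA hα hG hg hε0 hε1 hβ'
    hadm (hT T le_rfl).2 (fun t ht ↦ (hT t ht).1.1) fun t ht ↦ (hT t ht).1.2

theorem theorem4 (m : ℕ) (hm : 0 < m)
    (a : ℝ → ℝ) (b h : Fin m → ℝ → ℝ) (R : Fin m → ℝ → ℝ → ℝ)
    -- the coefficients are Lebesgue measurable and essentially bounded on `[0, ∞)`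
    (ha : MemLp a ⊤ (volume.restrict (Ici 0)))
    (hb : ∀ k, MemLp (b k) ⊤ (volume.restrict (Ici 0)))
    (a₀ : ℝ) (ha₀ : 0 < a₀) (ha_ge : ∀ t, 0 ≤ t → a₀ ≤ a t)
    (hb_nonneg : ∀ k t, 0 ≤ t → 0 ≤ b k t)
    -- the delay functions
    (hh_meas : ∀ k, AEMeasurable (h k) (volume.restrict (Ici 0)))
    (hh_le : ∀ k t, 0 ≤ t → h k t ≤ t)
    (hh_lim : ∀ k, Tendsto (h k) atTop atTop)
    -- the distributions of the delays: nondecreasing in `s`, of total mass one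
    (hR_mono : ∀ k, ∀ᵐ t ∂(volume.restrict (Ici 0)), Monotone (R k t))
    (hR_mass : ∀ k, ∀ᵐ t ∂(volume.restrict (Ici 0)),
      stieltjesMeasure (R k t) (Icc (h k t) t) = 1)
    -- the two upper limits, assumed finite
    (h₀ β : ℝ)
    (hh₀ : limsup (fun t : ℝ => ((∫ s in (⨅ k, h k t)..t, a s : ℝ) : EReal)) atTop = (h₀ : EReal))
    (hβ : limsup (fun t : ℝ => (((∑ k, b k t) / a t : ℝ) : EReal)) atTop = (β : EReal))
    -- the stability condition; for `β = 0` its two sides are `+∞` and `-∞`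
    (hcond : β = 0 ∨
      1 / β * Real.exp (-h₀) > Real.log ((β ^ 2 + β) / (β ^ 2 + 1))) :
    ExponentiallyStable a b h R := by
  have hloc : ∀ {f : ℝ → ℝ}, MemLp f ⊤ (volume.restrict (Ici 0)) →
      LocallyIntegrableOn f (Ici 0) := fun hf ↦
    locallyIntegrableOn_of_locallyIntegrable_restrict (hf.locallyIntegrable le_top)
  exact theorem4_general m hm a b h R (hloc ha) (fun k ↦ hloc (hb k)) a₀ ha₀ ha_ge hb_nonneg
    (fun k ↦ (hh_lim k).eventually_ge_atTop 0) hR_mass h₀ β hh₀ hβ hcond
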